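/- Let $\mathbb{T}^\infty=\{(e^{i\theta_1},e^{i\theta_2},\dots)\}$ be the infinite torus with normalised Haar measure $m$ (the product of the normalised Haar measures of the factors). Let $\mathbb{Z}_0^\infty$ be the set of integer sequences $\nu=(\nu_1,\nu_2,\dots)$ with only finitely many non-zero entries, and let $\mathbb{N}_0^\infty\subset\mathbb{Z}_0^\infty$ be the set of those with all entries $\ge 0$. The Fourier coefficients of a finite complex Borel measure $\mu$ on $\mathbb{T}^\infty$ are $\widehat\mu(\nu)=\int e^{-i\nu\cdot\theta}\,d\mu$, those of $f\in L^1(\mathbb{T}^\infty)$ are $\widehat f(\nu)=\int e^{-i\nu\cdot\theta}f\,dm$, and the Fourier spectrum is the set of $\nu\in\mathbb{Z}_0^\infty$ whose coefficient is non-zero. For $0<r<1$ put $$\mu_r(e^{i\theta})=\sum_{\nu\in\mathbb{Z}_0^\infty}\widehat\mu(\nu)\,r^{|\nu_1|+2|\nu_2|+3|\nu_3|+\cdots}\,e^{i\nu\cdot\theta},$$ the value of the polyharmonic extension of $\mu$ at the point $(re^{i\theta_1},r^2e^{i\theta_2},r^3e^{i\theta_3},\dots)$. **Theorem.** Let $\mu$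 be a finite complex Borel measure on $\mathbb{T}^\infty$ with Lebesgue decomposition $d\mu=f\,dm+d\mu_s$, where $f\in L^1(\mathbb{T}^\infty)$, $\mu_s$ is singular with respect to $m$, and both $f$ and $\mu_s$ have Fourier spectrum contained in $\mathbb{N}_0^\infty\cup(-\mathbb{N}_0^\infty)$. Then the series defining $\mu_r(e^{i\theta})$ converges absolutely for every $r\in(0,1)$ and every $e^{i\theta}\in\mathbb{T}^\infty$, and for $m$-almost every $e^{i\theta}\in\mathbb{T}^\infty$ the radial limit $\mu^*(e^{i\theta}):=\lim_{r\to1^-}\mu_r(e^{i\theta})$ exists and $$\mu^*(e^{i\theta})=f(e^{i\theta}).$$ -/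

import Mathlib

open MeasureTheory Filter Topology

noncomputable section

namespace InfTorus

/-- The infinite torus `𝕋^∞ = {(e^{iθ₁}, e^{iθ₂}, …)}`. The point with angles `θ` is represented by
`x j = θ / 2π ∈ ℝ / ℤ`, so that `fourier k (x j) = e^{2πi k x j}` is the `k`-th power of the
coordinate `e^{iθ}`. Coordinates are numbered from `0`: `j : ℕ` is coordinate number `j + 1`. -/
abbrev Torus : Type := UnitAddTorus ℕ

/-- The Haar measure `m` of `𝕋^∞`: the product of the normalised Haar measures of the factors. -/
def haar : Measure Torus :=
  Measure.infinitePi fun _ : ℕ => (AddCircle.haarAddCircle : Measure UnitAddCircle)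

/-- The character `e^{i ν·θ}` of `𝕋^∞`, for a finitely supported multi-index `ν`. -/
def character (ν : ℕ →₀ ℤ) (θ : Torus) : ℂ :=
  ν.prod fun j k => fourier k (θ j)

/-- Fourier coefficient `∫ e^{-iν·θ} dμ(θ)` of a (finite) complex Borel measure on `𝕋^∞`. -/
def measureCoeff (μ : ComplexMeasure Torus) (ν : ℕ →₀ ℤ) : ℂ :=
  VectorMeasure.integral μ (character (-ν)) (ContinuousLinearMap.mul ℝ ℂ)

/-- Fourier coefficient `∫ e^{-iν·θ} f(θ) dm(θ)` of a function on `𝕋^∞`. -/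
def functionCoeff (f : Torus → ℂ) (ν : ℕ →₀ ℤ) : ℂ :=
  ∫ θ, character (-ν) θ * f θ ∂haar

/-- The family `c` of Fourier coefficients is supported on `ℕ₀^∞ ∪ (-ℕ₀^∞)`. -/
def SpectrumInHalves (c : (ℕ →₀ ℤ) → ℂ) : Prop :=
  ∀ ν, c ν ≠ 0 → (∀ j, 0 ≤ ν j) ∨ (∀ j, ν j ≤ 0)

/-- The weighted length `|ν₁| + 2|ν₂| + 3|ν₃| + ⋯`. -/
def weightedLength (ν : ℕ →₀ ℤ) : ℕ :=
  ν.sum fun j k => (j + 1) * k.natAbs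

/-- The term of index `ν` in the series of the polyharmonic extension of `μ` at the point
`(r e^{iθ₁}, r² e^{iθ₂}, r³ e^{iθ₃}, …)`. -/
def radialTerm (μ : ComplexMeasure Torus) (r : ℝ) (θ : Torus) (ν : ℕ →₀ ℤ) : ℂ :=
  measureCoeff μ ν * (r : ℂ) ^ weightedLength ν * character ν θ

/-- `μ_r(e^{iθ})`: the polyharmonic extension of `μ` at `(r e^{iθ₁}, r² e^{iθ₂}, …)`. -/
def radialExtension (μ : ComplexMeasure Torus) (r : ℝ) (θ : Torus) : ℂ :=
  ∑' ν : ℕ →₀ ℤ, radialTerm μ r θ ν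

end InfTorus

end

noncomputable section

namespace InfTorus

/-! The one-parameter subgroup `flow` t ↦ (t, 2t, 3t, …) reduces the theorem to Fatou's theorem on
the circle. On an orbit y + `flow` t the character ν has frequency `flowDegree ν`, and when the
entries of ν share a sign this is `weightedLength ν` up to sign (`weightedLength_eq`). Along an
orbit μ_r is therefore the Poisson series ∑ r^|n| c_n(y) e^{2πint} with c_n = `orbitCoeff c n`
(`hasSum_orbitCoeff`).

It remains to recognise the c_n(y) as Fourier coefficients of a measure on the circle with
absolutely continuous part f(y + `flow` t) dt. Write μ_s = g dp with p positive, finite and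
singular. The shear (x, t) ↦ (x - `flow` t, t) carries p × dt to a measure on 𝕋^∞ × 𝕋, which is
disintegrated over its first marginal. Let h be the density of the absolutely continuous part of
this marginal. Comparing Fourier coefficients in y, `exists_density_of_integral_character_eq` gives
c_n(y) = α_n(y) + h(y) B_n(y) for m-almost every y, where α_n and B_n are the coefficients of the
slices of f dm and g dp. For almost every y with h(y) ≠ 0 the slice of p is singular
(`ae_condKernel_mutuallySingular`).

Fatou's theorem (`ae_tendsto_circlePoisson`, `ae_tendsto_circlePoisson_of_mutuallySingular`) then
gives the limit f at almost every point of almost every orbit, and the invariance of m under the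
flow (`ae_haar_of_ae_flow`) gives it m-almost everywhere. -/

/-! ### The Poisson kernel of the disc and its dyadic majorant -/

/-- The Poisson kernel `∑ r^{|n|} e^{2πi n s}` of the unit disc. -/
def circlePoisson (r : ℝ) (s : UnitAddCircle) : ℂ :=
  ∑' n : ℤ, (r : ℂ) ^ n.natAbs * fourier n s

lemma norm_fourier_apply (n : ℤ) (s : UnitAddCircle) : ‖fourier n s‖ = 1 := by
  rw [fourier_apply]; exact Circle.norm_coe _

lemma summable_pow_natAbs {r : ℝ} (hr : r ∈ Set.Ioo (0 : ℝ) 1) :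
    Summable fun n : ℤ => r ^ n.natAbs := by
  have h := summable_geometric_of_lt_one hr.1.le hr.2
  refine Summable.of_nat_of_neg ?_ ?_ <;> simpa using h

lemma summable_circlePoisson {r : ℝ} (hr : r ∈ Set.Ioo (0 : ℝ) 1) (s : UnitAddCircle) :
    Summable fun n : ℤ => (r : ℂ) ^ n.natAbs * fourier n s := by
  refine Summable.of_norm_bounded (summable_pow_natAbs hr) fun n => ?_
  rw [norm_mul, norm_fourier_apply, norm_pow, Complex.norm_real, Real.norm_of_nonneg hr.1.le,
    mul_one]

lemma fourier_natCast (n : ℕ) (s : UnitAddCircle) : fourier (n : ℤ) s = fourier 1 s ^ n := by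
  simp [fourier_apply, AddCircle.toCircle_nsmul]

lemma continuous_circlePoisson {r : ℝ} (hr : r ∈ Set.Ioo (0 : ℝ) 1) :
    Continuous (circlePoisson r) := by
  refine continuous_tsum (fun n => by fun_prop) (summable_pow_natAbs hr) fun n s => ?_
  rw [norm_mul, norm_fourier_apply, norm_pow, Complex.norm_real, Real.norm_of_nonneg hr.1.le,
    mul_one]

lemma circlePoisson_eq {r : ℝ} (hr : r ∈ Set.Ioo (0 : ℝ) 1) (s : UnitAddCircle) :
    circlePoisson r s = (1 - (r : ℂ) ^ 2) / (‖1 - r * fourier 1 s‖ ^ 2 : ℝ) := by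
  set z : ℂ := fourier 1 s with hz
  have hz1 : ‖z‖ = 1 := norm_fourier_apply 1 s
  have hzz : z * (starRingEnd ℂ) z = 1 := by
    rw [Complex.mul_conj, Complex.normSq_eq_norm_sq, hz1]; simp
  have hrz : ‖(r : ℂ) * z‖ < 1 := by
    rw [norm_mul, hz1, Complex.norm_real, Real.norm_of_nonneg hr.1.le, mul_one]; exact hr.2
  have hrz' : ‖(r : ℂ) * (starRingEnd ℂ) z‖ < 1 := by
    rw [norm_mul, RCLike.norm_conj, hz1, Complex.norm_real, Real.norm_of_nonneg hr.1.le, mul_one]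
    exact hr.2
  have h1 : HasSum (fun n : ℕ => (r : ℂ) ^ (n : ℤ).natAbs * fourier (n : ℤ) s)
      (1 - r * z)⁻¹ := by
    refine (hasSum_geometric_of_norm_lt_one hrz).congr_fun fun n => ?_
    rw [fourier_natCast, mul_pow, Int.natAbs_natCast]
  have h2 : HasSum (fun n : ℕ => (r : ℂ) ^ (-((n : ℤ) + 1)).natAbs * fourier (-((n : ℤ) + 1)) s)
      (r * (starRingEnd ℂ) z * (1 - r * (starRingEnd ℂ) z)⁻¹) := by
    refine ((hasSum_geometric_of_norm_lt_one hrz').mul_left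
      (r * (starRingEnd ℂ) z)).congr_fun fun n => ?_
    rw [fourier_neg, ← Nat.cast_succ, fourier_natCast, map_pow, Int.natAbs_neg, Int.natAbs_natCast,
      ← pow_succ', mul_pow]
  have h3 := (HasSum.of_nat_of_neg_add_one (f := fun n : ℤ => (r : ℂ) ^ n.natAbs * fourier n s)
    h1 h2).tsum_eq
  rw [circlePoisson, h3]
  have e1 : (1 : ℂ) - r * z ≠ 0 := by
    intro h; rw [sub_eq_zero] at h; rw [← h] at hrz; simp at hrz
  have e2 : (1 : ℂ) - r * (starRingEnd ℂ) z ≠ 0 := by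
    intro h; rw [sub_eq_zero] at h; rw [← h] at hrz'; simp at hrz'
  have e3 : ((‖1 - r * z‖ ^ 2 : ℝ) : ℂ) = (1 - r * z) * (1 - r * (starRingEnd ℂ) z) := by
    rw [← Complex.normSq_eq_norm_sq, ← Complex.mul_conj]; simp
  rw [e3]
  field_simp
  linear_combination (-(r:ℂ)^2) * hzz

/-- The chord has length 2|sin πy| with |y| ≤ 1/2, and Jordan's inequality bounds the sine below. -/
lemma norm_le_norm_fourier_one_sub_one (s : UnitAddCircle) : 4 * ‖s‖ ≤ ‖fourier 1 s - 1‖ := by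
  induction s using QuotientAddGroup.induction_on with
  | H x =>
  have h0 : ((x : ℝ) : UnitAddCircle) = ((x - round x : ℝ) : UnitAddCircle) := by
    rw [AddCircle.coe_sub, eq_comm, sub_eq_self, AddCircle.coe_eq_zero_iff]
    exact ⟨round x, by simp⟩
  change 4 * ‖((x : ℝ) : UnitAddCircle)‖ ≤ ‖fourier 1 ((x : ℝ) : UnitAddCircle) - 1‖
  rw [UnitAddCircle.norm_eq, h0, fourier_coe_apply]
  have hy : |x - round x| ≤ 1 / 2 := abs_sub_round x
  generalize x - round x = y at hy
  have : Complex.exp (2 * Real.pi * Complex.I * (1 : ℤ) * y / (1 : ℝ)) =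
      Complex.exp (Complex.I * (2 * Real.pi * y : ℝ)) := by
    congr 1; push_cast; ring
  rw [this, Complex.norm_exp_I_mul_ofReal_sub_one, norm_mul,
    show 2 * Real.pi * y / 2 = Real.pi * y by ring]
  have hs : |Real.sin (Real.pi * y)| = Real.sin (Real.pi * |y|) := by
    rcases abs_cases y with ⟨h, h'⟩ | ⟨h, h'⟩
    · rw [h, abs_of_nonneg]
      exact Real.sin_nonneg_of_nonneg_of_le_pi (by positivity)
        (by nlinarith [Real.pi_pos, abs_le.1 hy])
    · rw [h, mul_neg, Real.sin_neg, abs_of_nonpos]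
      exact Real.sin_nonpos_of_nonpos_of_neg_pi_le (by nlinarith [Real.pi_pos])
        (by nlinarith [Real.pi_pos, abs_le.1 hy])
  have h2 := Real.mul_le_sin (x := Real.pi * |y|) (by positivity)
    (by nlinarith [Real.pi_pos])
  rw [Real.norm_eq_abs, Real.norm_eq_abs, hs, abs_two]
  have : 2 / Real.pi * (Real.pi * |y|) = 2 * |y| := by field_simp
  linarith

/-- The denominator |1 - rz| dominates both 1 - r and ‖s‖. For the latter, 4r‖s‖ ≤ |r(z - 1)| ≤ |1 -
rz| + (1 - r) ≤ 2|1 - rz|, and r ≥ 1/2 absorbs the factor. -/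
lemma norm_circlePoisson_le {r : ℝ} (hr : r ∈ Set.Ico (1 / 2 : ℝ) 1) (s : UnitAddCircle) {m : ℝ}
    (hm0 : 0 < m) (hm : m ≤ max (1 - r) ‖s‖) :
    ‖circlePoisson r s‖ ≤ 2 * (1 - r) / m ^ 2 := by
  have hr' : r ∈ Set.Ioo (0 : ℝ) 1 := ⟨by linarith [hr.1], hr.2⟩
  rw [circlePoisson_eq hr', norm_div, Complex.norm_real, Real.norm_of_nonneg (by positivity),
    show (1 : ℂ) - (r : ℂ) ^ 2 = ((1 - r ^ 2 : ℝ) : ℂ) by push_cast; rfl, Complex.norm_real,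
    Real.norm_of_nonneg (by nlinarith [hr'.1, hr'.2])]
  set z : ℂ := fourier 1 s with hz
  have hz1 : ‖z‖ = 1 := norm_fourier_apply 1 s
  have hrr : ‖(r : ℂ)‖ = r := by rw [Complex.norm_real, Real.norm_of_nonneg hr'.1.le]
  have h1 : 1 - r ≤ ‖1 - r * z‖ := by
    have := norm_sub_norm_le (1 : ℂ) (r * z)
    rw [norm_one, norm_mul, hz1, hrr] at this
    linarith
  have h2 : ‖s‖ ≤ ‖1 - r * z‖ := by
    have h3 : ‖(r : ℂ) * (z - 1)‖ ≤ ‖1 - r * z‖ + (1 - r) := by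
      have e : (r : ℂ) * (z - 1) = -(1 - r * z) + ((1 - r : ℝ) : ℂ) := by push_cast; ring
      rw [e]
      refine (norm_add_le _ _).trans ?_
      rw [norm_neg, Complex.norm_real, Real.norm_of_nonneg (by linarith [hr.2])]
    rw [norm_mul, hrr] at h3
    have h4 := norm_le_norm_fourier_one_sub_one s
    rw [← hz] at h4
    nlinarith [hr.1, norm_nonneg s]
  have h3 : m ≤ ‖1 - r * z‖ := hm.trans (max_le h1 h2)
  have h4 : m ^ 2 ≤ ‖1 - r * z‖ ^ 2 := by gcongr
  apply div_le_div₀ (by linarith [hr.2]) _ (by positivity) h4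
  nlinarith [hr.1, hr.2]

/-- With j least such that ‖t - s‖ ≤ 2^j (1 - r), the preceding bound applies with m = 2^j (1 - r) /
2. Majorising by indicators of balls makes only the masses of balls matter. -/
lemma enorm_circlePoisson_le_tsum {r : ℝ} (hr : r ∈ Set.Ico (1 / 2 : ℝ) 1) (t s : UnitAddCircle) :
    ‖circlePoisson r (t - s)‖ₑ ≤ ∑' j : ℕ, ENNReal.ofReal (8 / (4 ^ j * (1 - r))) *
      (Metric.closedBall t (2 ^ j * (1 - r))).indicator 1 s := by
  have h0 : 0 < 1 - r := by linarith [hr.2]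
  have hex : ∃ j : ℕ, ‖t - s‖ ≤ 2 ^ j * (1 - r) := by
    obtain ⟨j, hj⟩ := pow_unbounded_of_one_lt (‖t - s‖ / (1 - r)) (one_lt_two)
    exact ⟨j, ((div_lt_iff₀ h0).1 hj).le⟩
  classical
  obtain ⟨j, hj, hmin⟩ : ∃ j : ℕ, ‖t - s‖ ≤ 2 ^ j * (1 - r) ∧
      2 ^ j * (1 - r) / 2 ≤ max (1 - r) ‖t - s‖ := by
    refine ⟨Nat.find hex, Nat.find_spec hex, ?_⟩
    rcases Nat.eq_zero_or_eq_succ_pred (Nat.find hex) with h | h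
    · rw [h]; refine le_trans ?_ (le_max_left _ _); linarith
    · have := Nat.find_min hex (m := (Nat.find hex).pred) (by omega)
      rw [h, pow_succ]
      refine le_trans ?_ (le_max_right _ _)
      rw [not_le] at this
      linarith
  refine le_trans ?_ (ENNReal.le_tsum j)
  have hmem : s ∈ Metric.closedBall t (2 ^ j * (1 - r)) := by
    rw [Metric.mem_closedBall, dist_comm, dist_eq_norm]; exact hj
  rw [Set.indicator_of_mem hmem, Pi.one_apply, mul_one, ← ofReal_norm]
  apply ENNReal.ofReal_le_ofReal
  refine (norm_circlePoisson_le hr (t - s) (by positivity) hmin).trans_eq ?_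
  have h4 : (4 : ℝ) ^ j = 2 ^ j * 2 ^ j := by rw [← mul_pow]; norm_num
  rw [h4]
  field_simp
  ring

lemma lintegral_enorm_circlePoisson_le {r : ℝ} (hr : r ∈ Set.Ico (1 / 2 : ℝ) 1)
    (κ : Measure UnitAddCircle) [IsFiniteMeasure κ] (t : UnitAddCircle) :
    ∫⁻ s, ‖circlePoisson r (t - s)‖ₑ ∂κ ≤ ∑' j : ℕ, ENNReal.ofReal (8 * (1 / 2) ^ j *
      (κ.real (Metric.closedBall t (2 ^ j * (1 - r))) / (2 ^ j * (1 - r)))) := by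
  have h0 : 0 < 1 - r := by linarith [hr.2]
  calc ∫⁻ s, ‖circlePoisson r (t - s)‖ₑ ∂κ
      ≤ ∫⁻ s, ∑' j : ℕ, ENNReal.ofReal (8 / (4 ^ j * (1 - r))) *
        (Metric.closedBall t (2 ^ j * (1 - r))).indicator 1 s ∂κ :=
        lintegral_mono fun s => enorm_circlePoisson_le_tsum hr t s
    _ = ∑' j : ℕ, ENNReal.ofReal (8 / (4 ^ j * (1 - r))) *
        κ (Metric.closedBall t (2 ^ j * (1 - r))) := by
        rw [lintegral_tsum]
        · congr 1 with j
          rw [lintegral_const_mul _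
              (measurable_one.indicator Metric.isClosed_closedBall.measurableSet),
            lintegral_indicator_one Metric.isClosed_closedBall.measurableSet]
        · intro j
          exact ((measurable_one.indicator Metric.isClosed_closedBall.measurableSet).const_mul
            _).aemeasurable
    _ = _ := by
        congr 1 with j
        rw [← ofReal_measureReal (μ := κ), ← ENNReal.ofReal_mul (by positivity)]
        congr 1
        have h4 : (4 : ℝ) ^ j = 2 ^ j * 2 ^ j := by rw [← mul_pow]; norm_num
        rw [h4, one_div, inv_pow]
        field_simp

/-- Each dyadic term is 8 · 2^{-j} times a density ratio of κ at t, so dominated convergence over j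
applies once the ratios are bounded. -/
theorem tendsto_lintegral_enorm_circlePoisson (κ : Measure UnitAddCircle) [IsFiniteMeasure κ]
    {t : UnitAddCircle}
    (h : Tendsto (fun ε : ℝ => κ.real (Metric.closedBall t ε) / ε) (𝓝[>] 0) (𝓝 0)) :
    Tendsto (fun r : ℝ => ∫⁻ s, ‖circlePoisson r (t - s)‖ₑ ∂κ) (𝓝[<] 1) (𝓝 0) := by
  -- The bound is needed for every ε, since the radii 2^j (1 - r) are unbounded in j; large ε are
  -- handled by the total mass.
  obtain ⟨C, hC0, hC⟩ : ∃ C : ℝ, 0 ≤ C ∧ ∀ ε > 0, κ.real (Metric.closedBall t ε) / ε ≤ C := by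
    have h1 : ∀ᶠ ε : ℝ in 𝓝[>] 0, κ.real (Metric.closedBall t ε) / ε < 1 :=
      h.eventually (gt_mem_nhds one_pos)
    obtain ⟨δ, hδ, hδ'⟩ := mem_nhdsGT_iff_exists_Ioo_subset.1 h1
    rw [Set.mem_Ioi] at hδ
    refine ⟨max 1 (κ.real Set.univ / δ), by positivity, fun ε hε => ?_⟩
    rcases lt_or_ge ε δ with h2 | h2
    · exact (show κ.real (Metric.closedBall t ε) / ε < 1 from hδ' ⟨hε, h2⟩).le.trans
        (le_max_left _ _)
    · refine le_trans ?_ (le_max_right _ _)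
      exact div_le_div₀ measureReal_nonneg (measureReal_mono (Set.subset_univ _)) hδ h2
  have hT : Tendsto (fun r : ℝ => ∑' j : ℕ, 8 * (1 / 2) ^ j *
      (κ.real (Metric.closedBall t (2 ^ j * (1 - r))) / (2 ^ j * (1 - r)))) (𝓝[<] 1)
      (𝓝 (∑' _ : ℕ, (0 : ℝ))) := by
    refine tendsto_tsum_of_dominated_convergence (bound := fun j : ℕ => 8 * (1 / 2) ^ j * C)
      ((summable_geometric_two.mul_left 8).mul_right C) (fun j => ?_) ?_
    · have h1 : Tendsto (fun r : ℝ => 2 ^ j * (1 - r)) (𝓝[<] 1) (𝓝[>] 0) := by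
        refine tendsto_nhdsWithin_iff.2 ⟨?_, ?_⟩
        · have : Continuous fun r : ℝ => (2 : ℝ) ^ j * (1 - r) := by fun_prop
          simpa using (this.tendsto 1).mono_left nhdsWithin_le_nhds
        · filter_upwards [self_mem_nhdsWithin] with r hr
          have : 0 < 1 - r := by simpa using hr
          exact Set.mem_Ioi.2 (by positivity)
      have h2 := (h.comp h1).const_mul (8 * (1 / 2) ^ j)
      rwa [mul_zero] at h2
    · filter_upwards [self_mem_nhdsWithin] with r hr j
      have h0 : 0 < 1 - r := by simpa using hr
      rw [Real.norm_of_nonneg (by positivity)]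
      gcongr
      exact hC _ (by positivity)
  rw [tsum_zero] at hT
  have hT' := ENNReal.tendsto_ofReal hT
  rw [ENNReal.ofReal_zero] at hT'
  refine tendsto_of_tendsto_of_tendsto_of_le_of_le' tendsto_const_nhds hT'
    (Eventually.of_forall fun _ => zero_le) ?_
  have hmem : Set.Ioo (1 / 2 : ℝ) 1 ∈ 𝓝[<] (1 : ℝ) := Ioo_mem_nhdsLT (by norm_num)
  filter_upwards [hmem] with r hr
  have h0 : 0 < 1 - r := by linarith [hr.2]
  refine (lintegral_enorm_circlePoisson_le ⟨hr.1.le, hr.2⟩ κ t).trans_eq ?_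
  rw [ENNReal.ofReal_tsum_of_nonneg (fun j => by positivity)]
  refine Summable.of_nonneg_of_le (fun j => by positivity) (fun j => ?_)
    ((summable_geometric_two.mul_left 8).mul_right C)
  gcongr
  exact hC _ (by positivity)

/-! ### Poisson integrals and Fatou's theorem on the circle -/

lemma fourier_sub_apply (n : ℤ) (t s : UnitAddCircle) :
    fourier n (t - s) = fourier n t * fourier (-n) s := by
  simp [fourier_apply, sub_eq_add_neg, smul_add, AddCircle.toCircle_add]

theorem hasSum_integral_circlePoisson {r : ℝ} (hr : r ∈ Set.Ioo (0 : ℝ) 1)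
    {κ : Measure UnitAddCircle} {g : UnitAddCircle → ℂ} (hg : Integrable g κ)
    (t : UnitAddCircle) :
    HasSum (fun n : ℤ => (r : ℂ) ^ n.natAbs * fourier n t * ∫ s, fourier (-n) s * g s ∂κ)
      (∫ s, circlePoisson r (t - s) * g s ∂κ) := by
  have h := hasSum_integral_of_dominated_convergence (μ := κ)
    (F := fun (n : ℤ) s => (r : ℂ) ^ n.natAbs * fourier n (t - s) * g s)
    (f := fun s => circlePoisson r (t - s) * g s)
    (fun n s => r ^ n.natAbs * ‖g s‖) ?_ ?_ ?_ ?_ ?_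
  · refine h.congr_fun fun n => ?_
    rw [← integral_const_mul]
    congr 1 with s
    rw [fourier_sub_apply]; ring
  · intro n
    exact (Continuous.aestronglyMeasurable (by fun_prop)).mul hg.1
  · intro n
    filter_upwards with s
    rw [norm_mul, norm_mul, norm_fourier_apply, norm_pow, Complex.norm_real,
      Real.norm_of_nonneg hr.1.le, mul_one]
  · filter_upwards with s
    exact (summable_pow_natAbs hr).mul_right _
  · simp_rw [tsum_mul_right]
    exact hg.norm.const_mul _
  · filter_upwards with s
    exact (summable_circlePoisson hr (t - s)).hasSum.mul_right _

lemma integral_fourier_neg (n : ℤ) :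
    ∫ s, fourier (-n) s ∂(AddCircle.haarAddCircle : Measure UnitAddCircle) =
      if n = 0 then 1 else 0 := by
  have h := orthonormal_iff_ite.1 (orthonormal_fourier (T := 1)) n 0
  rw [ContinuousMap.inner_toLp (𝕜 := ℂ)] at h
  simpa using h

lemma integral_circlePoisson {r : ℝ} (hr : r ∈ Set.Ioo (0 : ℝ) 1) (t : UnitAddCircle) :
    ∫ s, circlePoisson r (t - s) ∂(AddCircle.haarAddCircle : Measure UnitAddCircle) = 1 := by
  have h := hasSum_integral_circlePoisson hr (κ := (AddCircle.haarAddCircle : Measure UnitAddCircle))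
    (g := fun _ => 1) (integrable_const _) t
  simp only [mul_one, integral_fourier_neg] at h
  refine h.unique ?_
  convert hasSum_ite_eq (0 : ℤ) (1 : ℂ) using 2 with n
  split_ifs with hn <;> simp [hn]

lemma haarAddCircle_eq_volume :
    (AddCircle.haarAddCircle : Measure UnitAddCircle) = volume := by
  rw [AddCircle.volume_eq_smul_haarAddCircle]; simp

lemma tendsto_lintegral_enorm_circlePoisson_of_average (κ : Measure UnitAddCircle)
    [IsFiniteMeasure κ] {t : UnitAddCircle}
    (h : Tendsto (fun ε : ℝ => κ.real (Metric.closedBall t ε) /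
      (volume : Measure UnitAddCircle).real (Metric.closedBall t ε)) (𝓝[>] 0) (𝓝 0)) :
    Tendsto (fun r : ℝ => ∫⁻ s, ‖circlePoisson r (t - s)‖ₑ ∂κ) (𝓝[<] 1) (𝓝 0) := by
  apply tendsto_lintegral_enorm_circlePoisson
  have h2 := h.mul_const 2
  rw [zero_mul] at h2
  refine squeeze_zero' ?_ ?_ h2
  · filter_upwards [self_mem_nhdsWithin] with ε (hε : 0 < ε)
    positivity
  · filter_upwards [self_mem_nhdsWithin] with ε (hε : 0 < ε)
    have hv : (volume : Measure UnitAddCircle).real (Metric.closedBall t ε) = min 1 (2 * ε) := by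
      rw [measureReal_def, AddCircle.volume_closedBall, ENNReal.toReal_ofReal (by positivity)]
    have hm : 0 < min 1 (2 * ε) := by positivity
    have hm' : min 1 (2 * ε) ≤ 2 * ε := min_le_right _ _
    rw [hv, div_le_iff₀ hε]
    calc κ.real (Metric.closedBall t ε)
        = κ.real (Metric.closedBall t ε) / min 1 (2 * ε) * min 1 (2 * ε) := by field_simp
      _ ≤ κ.real (Metric.closedBall t ε) / min 1 (2 * ε) * (2 * ε) := by gcongr
      _ = _ := by ring

/-- Passes from the complex measure g dκ to the positive measure |g| dκ, to which the density
criterion applies. -/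
lemma tendsto_integral_circlePoisson_of_withDensity {κ : Measure UnitAddCircle}
    {g : UnitAddCircle → ℂ} (hg : AEStronglyMeasurable g κ) {t : UnitAddCircle}
    (h : Tendsto (fun r : ℝ => ∫⁻ s, ‖circlePoisson r (t - s)‖ₑ ∂κ.withDensity (‖g ·‖ₑ))
      (𝓝[<] 1) (𝓝 0)) :
    Tendsto (fun r : ℝ => ∫ s, circlePoisson r (t - s) * g s ∂κ) (𝓝[<] 1) (𝓝 0) := by
  rw [tendsto_zero_iff_enorm_tendsto_zero]
  refine tendsto_of_tendsto_of_tendsto_of_le_of_le' tendsto_const_nhds h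
    (Eventually.of_forall fun _ => zero_le) ?_
  filter_upwards [Ioo_mem_nhdsLT (zero_lt_one' ℝ)] with r hr
  refine (enorm_integral_le_lintegral_enorm _).trans_eq ?_
  rw [lintegral_withDensity_eq_lintegral_mul₀ hg.enorm]
  · simp [enorm_mul, mul_comm]
  · exact ((continuous_circlePoisson hr).comp
      (continuous_const.sub continuous_id)).enorm.measurable.aemeasurable

/-- The Poisson integral of an integrable function on the circle converges radially a.e. -/
theorem ae_tendsto_circlePoisson {g : UnitAddCircle → ℂ}
    (hg : Integrable g (AddCircle.haarAddCircle : Measure UnitAddCircle)) :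
    ∀ᵐ t ∂(AddCircle.haarAddCircle : Measure UnitAddCircle),
      Tendsto (fun r : ℝ => ∫ s, circlePoisson r (t - s) * g s ∂AddCircle.haarAddCircle)
        (𝓝[<] 1) (𝓝 (g t)) := by
  rw [haarAddCircle_eq_volume] at hg ⊢
  -- At a Lebesgue point t the measure |g - g(t)| ds has density zero, and since the kernel has
  -- integral one the error is the Poisson integral of g - g(t).
  filter_upwards [IsUnifLocDoublingMeasure.ae_tendsto_average_norm_sub
    (volume : Measure UnitAddCircle) hg.locallyIntegrable 0] with t ht
  have hgt : Integrable (fun s => g s - g t) (volume : Measure UnitAddCircle) :=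
    hg.sub (integrable_const _)
  have : IsFiniteMeasure ((volume : Measure UnitAddCircle).withDensity (‖g · - g t‖ₑ)) :=
    isFiniteMeasure_withDensity hgt.2.ne
  have h1 := ht (fun _ : ℝ => t) id (l := 𝓝[>] 0) tendsto_id (by simp)
  have h2 := tendsto_integral_circlePoisson_of_withDensity hgt.1
    (tendsto_lintegral_enorm_circlePoisson_of_average _ (t := t) ?_)
  · have h3 := h2.add_const (g t)
    rw [zero_add] at h3
    refine h3.congr' ?_
    filter_upwards [Ioo_mem_nhdsLT (zero_lt_one' ℝ)] with r hr
    have hc : Continuous fun s => circlePoisson r (t - s) :=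
      (continuous_circlePoisson hr).comp (continuous_const.sub continuous_id)
    have hci : Integrable (fun s => circlePoisson r (t - s)) (volume : Measure UnitAddCircle) :=
      hc.integrable_of_hasCompactSupport (HasCompactSupport.of_compactSpace _)
    have hi := integral_circlePoisson hr t
    rw [haarAddCircle_eq_volume] at hi
    simp_rw [mul_sub]
    rw [integral_sub, integral_mul_const, hi]
    · ring
    · obtain ⟨C, hC⟩ := (isCompact_range hc).isBounded.exists_norm_le
      exact hg.bdd_mul hc.aestronglyMeasurable (c := C)
        (Eventually.of_forall fun s => hC _ ⟨s, rfl⟩)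
    · exact hci.mul_const _
  · refine h1.congr fun ε => ?_
    rw [setAverage_eq, smul_eq_mul, div_eq_inv_mul, id]
    congr 1
    rw [measureReal_def, withDensity_apply _ Metric.isClosed_closedBall.measurableSet,
      integral_norm_eq_lintegral_enorm hgt.1.restrict]

/-- The Poisson integral of a singular measure on the circle has radial limit zero a.e. -/
theorem ae_tendsto_circlePoisson_of_mutuallySingular {κ : Measure UnitAddCircle}
    [IsFiniteMeasure κ] (hκ : κ ⟂ₘ AddCircle.haarAddCircle) {g : UnitAddCircle → ℂ}
    (hg : Integrable g κ) :
    ∀ᵐ t ∂(AddCircle.haarAddCircle : Measure UnitAddCircle),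
      Tendsto (fun r : ℝ => ∫ s, circlePoisson r (t - s) * g s ∂κ) (𝓝[<] 1) (𝓝 0) := by
  rw [haarAddCircle_eq_volume] at hκ ⊢
  have : IsFiniteMeasure (κ.withDensity (‖g ·‖ₑ)) := isFiniteMeasure_withDensity hg.2.ne
  have hs : κ.withDensity (‖g ·‖ₑ) ⟂ₘ volume :=
    hκ.mono_ac (withDensity_absolutelyContinuous _ _) Measure.AbsolutelyContinuous.rfl
  -- A singular measure has derivative zero at almost every point.
  filter_upwards [(IsUnifLocDoublingMeasure.vitaliFamily
    (volume : Measure UnitAddCircle) 0).ae_eventually_measure_zero_of_singular hs] with t ht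
  refine tendsto_integral_circlePoisson_of_withDensity hg.1
    (tendsto_lintegral_enorm_circlePoisson_of_average _ ?_)
  have h1 := ht.comp (IsUnifLocDoublingMeasure.tendsto_closedBall_filterAt
    (volume : Measure UnitAddCircle) (fun _ : ℝ => t) id (l := 𝓝[>] 0) tendsto_id (by simp))
  have h2 := (ENNReal.tendsto_toReal ENNReal.zero_ne_top).comp h1
  rw [ENNReal.toReal_zero] at h2
  refine h2.congr fun ε => ?_
  simp [measureReal_def, ENNReal.toReal_div]

/-! ### Characters of the infinite torus and uniqueness of Fourier coefficients -/

lemma norm_character (ν : ℕ →₀ ℤ) (θ : Torus) : ‖character ν θ‖ = 1 := by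
  simp [character, Finsupp.prod, norm_fourier_apply, -fourier_apply]

lemma continuous_character (ν : ℕ →₀ ℤ) : Continuous (character ν) := by
  unfold character Finsupp.prod
  fun_prop

lemma character_zero (θ : Torus) : character 0 θ = 1 := by simp [character]

lemma character_add (ν ν' : ℕ →₀ ℤ) (θ : Torus) :
    character (ν + ν') θ = character ν θ * character ν' θ :=
  Finsupp.prod_add_index' (fun _ => fourier_zero) fun _ _ _ => fourier_add

lemma character_neg (ν : ℕ →₀ ℤ) (θ : Torus) :
    character (-ν) θ = (starRingEnd ℂ) (character ν θ) := by
  rw [character, Finsupp.prod_neg_index (h := fun j k => fourier k (θ j)) (fun _ => fourier_zero),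
    character, Finsupp.prod, Finsupp.prod, map_prod]
  simp_rw [fourier_neg]

lemma character_neg_mul_self (ν : ℕ →₀ ℤ) (θ : Torus) :
    character (-ν) θ * character ν θ = 1 := by
  rw [← character_add, neg_add_cancel, character_zero]

lemma character_apply_add (ν : ℕ →₀ ℤ) (θ θ' : Torus) :
    character ν (θ + θ') = character ν θ * character ν θ' := by
  simp [character, Finsupp.prod, ← Finset.prod_mul_distrib, fourier_apply, smul_add,
    AddCircle.toCircle_add]

lemma character_single (j : ℕ) (k : ℤ) (θ : Torus) :
    character (Finsupp.single j k) θ = fourier k (θ j) := by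
  rw [character, Finsupp.prod_single_index]; exact fourier_zero

lemma integrable_character_mul {q : Measure Torus} {G : Torus → ℂ} (hG : Integrable G q)
    (ν : ℕ →₀ ℤ) : Integrable (fun θ => character ν θ * G θ) q :=
  hG.bdd_mul (c := 1) (continuous_character ν).aestronglyMeasurable
    (Eventually.of_forall fun θ => (norm_character ν θ).le)

/-- The character `e^{i ν·θ}` as a bounded continuous function. -/
def boundedCharacter (ν : ℕ →₀ ℤ) : BoundedContinuousFunction Torus ℂ :=
  BoundedContinuousFunction.mkOfCompact ⟨character ν, continuous_character ν⟩

/-- The star algebra of trigonometric polynomials on the infinite torus. -/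
def trigPolynomials : StarSubalgebra ℂ (BoundedContinuousFunction Torus ℂ) where
  toSubalgebra := Algebra.adjoin ℂ (Set.range boundedCharacter)
  star_mem' := by
    change Algebra.adjoin ℂ (Set.range boundedCharacter) ≤
      star (Algebra.adjoin ℂ (Set.range boundedCharacter))
    refine Algebra.adjoin_le ?_
    rintro _ ⟨ν, rfl⟩
    refine Algebra.subset_adjoin ⟨-ν, ?_⟩
    ext1 θ
    exact character_neg ν θ

/-- Products of characters are characters, so by linearity it is enough to test integrals on
characters. -/
lemma trigPolynomials_toSubmodule :
    Subalgebra.toSubmodule trigPolynomials.toSubalgebra =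
      Submodule.span ℂ (Set.range boundedCharacter) := by
  apply Algebra.adjoin_eq_span_of_subset
  refine .trans (fun x => Submonoid.closure_induction (fun _ => id) ⟨0, ?_⟩ ?_)
    Submodule.subset_span
  · ext θ; exact character_zero θ
  · rintro _ _ _ _ ⟨m, rfl⟩ ⟨n, rfl⟩
    exact ⟨m + n, by ext θ; exact character_add m n θ⟩

lemma trigPolynomials_separatesPoints :
    (trigPolynomials.map
      (BoundedContinuousFunction.toContinuousMapStarₐ ℂ)).SeparatesPoints := by
  intro x y hxy
  obtain ⟨j, hj⟩ := Function.ne_iff.1 hxy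
  refine ⟨character (Finsupp.single j 1), ⟨_, ⟨boundedCharacter (Finsupp.single j 1),
    Algebra.subset_adjoin ⟨_, rfl⟩, rfl⟩, rfl⟩, ?_⟩
  rw [character_single, character_single, fourier_one, fourier_one]
  contrapose hj
  rw [Circle.coe_inj] at hj
  exact AddCircle.injective_toCircle one_ne_zero hj

/-- Finite measures on the infinite torus are determined by their Fourier coefficients. -/
theorem ext_of_integral_character_eq {p q : Measure Torus} [IsFiniteMeasure p]
    [IsFiniteMeasure q] (h : ∀ ν, ∫ θ, character ν θ ∂p = ∫ θ, character ν θ ∂q) : p = q := by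
  refine ext_of_forall_mem_subalgebra_integral_eq_of_polish trigPolynomials_separatesPoints
    fun g hg => ?_
  have hg' : g ∈ Submodule.span ℂ (Set.range boundedCharacter) := by
    rw [← trigPolynomials_toSubmodule]; exact hg
  clear hg
  induction hg' using Submodule.span_induction with
  | mem x hx => obtain ⟨ν, rfl⟩ := hx; exact h ν
  | zero => simp
  | add x y _ _ hx hy =>
    simp only [BoundedContinuousFunction.add_apply]
    rw [integral_add (x.integrable p) (y.integrable p), integral_add (x.integrable q)
      (y.integrable q), hx, hy]
  | smul a x _ hx =>
    simp only [BoundedContinuousFunction.smul_apply]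
    rw [integral_smul, integral_smul, hx]

/-- The positive and negative parts of g define two finite positive measures with equal Fourier
coefficients, to which uniqueness for positive measures applies. -/
lemma ae_eq_zero_of_integral_character_real {q : Measure Torus}
    {g : Torus → ℝ} (hg : Integrable g q)
    (h : ∀ ν, ∫ θ, character ν θ * (g θ : ℂ) ∂q = 0) : g =ᵐ[q] 0 := by
  have fin : ∀ g : Torus → ℝ, Integrable g q →
      IsFiniteMeasure (q.withDensity fun θ => ENNReal.ofReal (g θ)) := fun g hg =>
    isFiniteMeasure_withDensity_ofReal hg.2
  have int : ∀ g : Torus → ℝ, Integrable g q → ∀ ν,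
      Integrable (fun θ => (ENNReal.ofReal (g θ)).toReal • character ν θ) q := fun g hg ν => by
    have h1 := integrable_character_mul (hg.pos_part.ofReal (𝕜 := ℂ)) ν
    refine h1.congr (Eventually.of_forall fun θ => ?_)
    simp [ENNReal.toReal_ofReal', mul_comm]
  have hr : ∀ g : Torus → ℝ, Integrable g q → ∀ ν,
      ∫ θ, character ν θ ∂(q.withDensity fun θ => ENNReal.ofReal (g θ)) =
        ∫ θ, (ENNReal.ofReal (g θ)).toReal • character ν θ ∂q := fun g hg ν =>
    integral_withDensity_eq_integral_toReal_smul₀ hg.1.aemeasurable.ennreal_ofReal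
      (Eventually.of_forall fun _ => ENNReal.ofReal_lt_top) _
  have := fin g hg
  have := fin (-g) hg.neg
  have key : (q.withDensity fun θ => ENNReal.ofReal (g θ)) =
      q.withDensity fun θ => ENNReal.ofReal ((-g) θ) := by
    refine ext_of_integral_character_eq fun ν => ?_
    rw [hr g hg, hr (-g) hg.neg, ← sub_eq_zero, ← integral_sub (int g hg ν) (int (-g) hg.neg ν),
      ← h ν]
    congr 1 with θ
    rw [← sub_smul, ENNReal.toReal_ofReal', ENNReal.toReal_ofReal', Pi.neg_apply,
      max_zero_sub_max_neg_zero_eq_self, Complex.real_smul, mul_comm]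
  have hae := (withDensity_eq_iff hg.1.aemeasurable.ennreal_ofReal
    hg.neg.1.aemeasurable.ennreal_ofReal (by
      have := hg.lintegral_lt_top; exact this.ne)).1 key
  filter_upwards [hae] with θ hθ
  have h1 := congrArg ENNReal.toReal hθ
  rw [ENNReal.toReal_ofReal', ENNReal.toReal_ofReal', ← sub_eq_zero, Pi.neg_apply,
      max_zero_sub_max_neg_zero_eq_self] at h1
  exact h1

/-- An integrable function on the infinite torus all of whose Fourier coefficients with respect to
a finite measure vanish is zero almost everywhere. -/
theorem ae_eq_zero_of_integral_character {q : Measure Torus}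
    {G : Torus → ℂ} (hG : Integrable G q) (h : ∀ ν, ∫ θ, character ν θ * G θ ∂q = 0) :
    G =ᵐ[q] 0 := by
  -- Characters are closed under conjugation, so the coefficients of the conjugate of G vanish too,
  -- hence those of its real and imaginary parts.
  have hc : ∀ ν, ∫ θ, character ν θ * (starRingEnd ℂ) (G θ) ∂q = 0 := fun ν => by
    rw [← map_zero (starRingEnd ℂ), ← h (-ν), ← integral_conj]
    simp_rw [map_mul, character_neg, Complex.conj_conj]
  have hGc : Integrable (fun θ => (starRingEnd ℂ) (G θ)) q :=
    (Complex.conjCLE : ℂ →L[ℝ] ℂ).integrable_comp hG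
  have hre := ae_eq_zero_of_integral_character_real hG.re (fun ν => by
    have := integral_add (integrable_character_mul hG ν) (integrable_character_mul hGc ν)
    rw [h, hc, add_zero] at this
    simp_rw [← mul_add, Complex.add_conj, Complex.ofReal_mul, mul_left_comm _ ((2 : ℝ) : ℂ)] at this
    rw [integral_const_mul] at this
    simpa using this)
  have him := ae_eq_zero_of_integral_character_real hG.im (fun ν => by
    have := integral_sub (integrable_character_mul hG ν) (integrable_character_mul hGc ν)
    rw [h, hc, sub_zero] at this
    simp_rw [← mul_sub, Complex.sub_conj, Complex.ofReal_mul, mul_assoc ((2 : ℝ) : ℂ),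
      mul_left_comm _ ((2 : ℝ) : ℂ), mul_comm _ Complex.I, mul_left_comm _ Complex.I] at this
    rw [integral_const_mul, integral_const_mul] at this
    simpa using this)
  filter_upwards [hre, him] with θ h1 h2
  exact Complex.ext h1 h2

/-! ### Absolute convergence of the series -/

lemma pow_weightedLength (r : ℝ) (ν : ℕ →₀ ℤ) :
    r ^ weightedLength ν = ν.prod fun j k => (r ^ (j + 1)) ^ k.natAbs := by
  simp [weightedLength, Finsupp.sum, Finsupp.prod, Finset.prod_pow_eq_pow_sum, ← pow_mul]

/-- The sum is 1 + 2x/(1 - x); the exponential form turns the product over coordinates into a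
convergent sum. -/
lemma tsum_pow_natAbs_le {x r : ℝ} (hr : r < 1) (hx : x ∈ Set.Icc (0 : ℝ) r) :
    ∑' k : ℤ, x ^ k.natAbs ≤ Real.exp (2 * x / (1 - r)) := by
  have hx1 : x < 1 := hx.2.trans_lt hr
  have h1 : HasSum (fun n : ℕ => x ^ (n : ℤ).natAbs) (1 - x)⁻¹ := by
    simpa using hasSum_geometric_of_lt_one hx.1 hx1
  have h2 : HasSum (fun n : ℕ => x ^ (-((n : ℤ) + 1)).natAbs) (x * (1 - x)⁻¹) := by
    refine ((hasSum_geometric_of_lt_one hx.1 hx1).mul_left x).congr_fun fun n => ?_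
    rw [Int.natAbs_neg, ← Nat.cast_succ, Int.natAbs_natCast, Nat.succ_eq_add_one, pow_succ']
  rw [(HasSum.of_nat_of_neg_add_one (f := fun n : ℤ => x ^ n.natAbs) h1 h2).tsum_eq]
  have h3 : 2 * x / (1 - r) + 1 ≤ Real.exp (2 * x / (1 - r)) := Real.add_one_le_exp _
  refine le_trans ?_ h3
  have e : (1 - x)⁻¹ + x * (1 - x)⁻¹ = 2 * x / (1 - x) + 1 := by
    have : 1 - x ≠ 0 := by linarith
    field_simp; ring
  rw [e]
  have := hx.1
  have : 0 < 1 - r := by linarith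
  gcongr
  exact hx.2

/-- The sum factors as ∏_j ∑_k (r^{j+1})^|k|, and ∑_j r^{j+1} converges. -/
lemma summable_pow_weightedLength {r : ℝ} (hr : r ∈ Set.Ioo (0 : ℝ) 1) :
    Summable fun ν : ℕ →₀ ℤ => r ^ weightedLength ν := by
  classical
  have h0 := hr.1.le
  have hr1 : 0 < 1 - r := by linarith [hr.2]
  have hgeo : Summable fun j : ℕ => 2 * r ^ (j + 1) / (1 - r) :=
    ((((summable_nat_add_iff 1).2 (summable_geometric_of_lt_one h0 hr.2))).mul_left 2).div_const _
  refine summable_of_sum_le (c := Real.exp (∑' j : ℕ, 2 * r ^ (j + 1) / (1 - r)))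
    (fun ν => by positivity) fun u => ?_
  -- The finite set `u` is enlarged to a box, over which the sum of products is a product of sums.
  set s : Finset ℕ := u.biUnion Finsupp.support with hs
  set T : ℕ → Finset ℤ := fun j => insert 0 (u.image fun ν => ν j) with hT
  have hsub : u ⊆ s.finsupp T := by
    intro ν hν
    rw [Finset.mem_finsupp_iff]
    refine ⟨fun j hj => Finset.mem_biUnion.2 ⟨ν, hν, hj⟩, fun j _ => ?_⟩
    exact Finset.mem_insert_of_mem (Finset.mem_image_of_mem _ hν)
  have hxj : ∀ j : ℕ, r ^ (j + 1) ∈ Set.Icc (0 : ℝ) r := fun j =>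
    ⟨by positivity, by simpa using pow_le_pow_of_le_one h0 hr.2.le (Nat.le_add_left 1 j)⟩
  calc ∑ ν ∈ u, r ^ weightedLength ν
      ≤ ∑ ν ∈ s.finsupp T, r ^ weightedLength ν :=
        Finset.sum_le_sum_of_subset_of_nonneg hsub fun _ _ _ => by positivity
    _ = ∏ j ∈ s, ∑ k ∈ T j, (r ^ (j + 1)) ^ k.natAbs := by
        rw [Finset.prod_sum, Finset.finsupp, Finset.sum_map]
        refine Finset.sum_congr (by congr 1; exact Subsingleton.elim _ _) fun f hf => ?_
        rw [pow_weightedLength, Finsupp.prod_of_support_subset (s := s)]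
        · rw [← Finset.prod_attach]
          refine Finset.prod_congr rfl fun j _ => ?_
          simp
        · simp [Finsupp.support_indicator_subset]
        · simp
    _ ≤ ∏ j ∈ s, Real.exp (2 * r ^ (j + 1) / (1 - r)) := by
        refine Finset.prod_le_prod (fun j _ => Finset.sum_nonneg fun k _ => by positivity)
          fun j _ => ?_
        refine le_trans ?_ (tsum_pow_natAbs_le hr.2 (hxj j))
        exact (summable_pow_natAbs ⟨pow_pos hr.1 _, (hxj j).2.trans_lt hr.2⟩).sum_le_tsum _
          fun k _ => by positivity
    _ = Real.exp (∑ j ∈ s, 2 * r ^ (j + 1) / (1 - r)) := (Real.exp_sum _ _).symm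
    _ ≤ _ := by
        gcongr
        exact hgeo.sum_le_tsum _ fun j _ => by positivity

/-! ### Invariance of the Haar measure and orthogonality of characters -/

instance : IsProbabilityMeasure haar := by unfold haar; infer_instance

lemma measurePreserving_add_right_haar (a : Torus) :
    MeasurePreserving (fun θ : Torus => θ + a) haar haar := by
  refine ⟨by fun_prop, ?_⟩
  have h := Measure.infinitePi_map_pi
    (μ := fun _ : ℕ => (AddCircle.haarAddCircle : Measure UnitAddCircle))
    (f := fun i x => x + a i) (fun i => by fun_prop)
  simp_rw [map_add_right_eq_self] at h
  exact h

lemma fourier_eq_one_iff {n : ℤ} : (∀ s : UnitAddCircle, fourier n s = 1) ↔ n = 0 := by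
  refine ⟨fun h => ?_, fun h s => by rw [h, fourier_zero]⟩
  by_contra hn
  have h1 := fourier_add_half_inv_index (T := 1) hn one_pos 0
  rw [h, h] at h1
  norm_num at h1

/-- If ν_j ≠ 0, a suitable translation in coordinate j multiplies the integral by a number other
than 1 while leaving it unchanged. -/
lemma integral_character_haar (ν : ℕ →₀ ℤ) :
    ∫ θ, character ν θ ∂haar = if ν = 0 then 1 else 0 := by
  split_ifs with h
  · simp [h, character_zero]
  · obtain ⟨j, hj⟩ := Finsupp.ne_iff.1 h
    obtain ⟨s, hs⟩ : ∃ s : UnitAddCircle, fourier (ν j) s ≠ 1 := by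
      by_contra! hc; exact hj (fourier_eq_one_iff.1 hc)
    have ha : character ν (Pi.single j s) = fourier (ν j) s := by
      rw [character, Finsupp.prod, Finset.prod_eq_single j]
      · simp
      · intro i _ hi; simp [hi]
      · intro hj'; simp [Finsupp.notMem_support_iff.1 hj']
    have h1 := (measurePreserving_add_right_haar (Pi.single j s)).integral_comp
      (MeasurableEquiv.addRight (Pi.single j s : Torus)).measurableEmbedding (character ν)
    simp_rw [character_apply_add, integral_mul_const, ha] at h1
    by_contra h0
    exact hs (mul_left_cancel₀ h0 (by rw [h1, mul_one]))

/-! ### The flow and the lift of measures along its orbits -/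

/-- The one-parameter subgroup `t ↦ (t, 2t, 3t, …)` of the infinite torus. -/
def flow (t : UnitAddCircle) : Torus := fun j => (j + 1) • t

lemma continuous_flow : Continuous flow := by
  unfold flow; fun_prop

/-- The degree `ν₁ + 2ν₂ + 3ν₃ + ⋯` of a character along the flow. -/
def flowDegree (ν : ℕ →₀ ℤ) : ℤ := ν.sum fun j k => (j + 1) * k

lemma character_flow (ν : ℕ →₀ ℤ) (t : UnitAddCircle) :
    character ν (flow t) = fourier (flowDegree ν) t := by
  simp only [character, Finsupp.prod, flowDegree, Finsupp.sum, flow]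
  induction ν.support using Finset.induction_on with
  | empty => simp
  | insert j s hj ih =>
    rw [Finset.prod_insert hj, Finset.sum_insert hj, fourier_add, ih]
    congr 1
    rw [fourier_apply, fourier_apply, ← natCast_zsmul, ← mul_zsmul, mul_comm]
    simp

lemma flowDegree_neg (ν : ℕ →₀ ℤ) : flowDegree (-ν) = -flowDegree ν := by
  rw [flowDegree, Finsupp.sum_neg_index (h := fun (j : ℕ) (k : ℤ) => ((j : ℤ) + 1) * k) (by simp),
    flowDegree]
  simp [Finsupp.sum]

/-- This is where the spectral hypothesis acts: with entries of one sign the absolute value passes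
outside the sum. -/
lemma weightedLength_eq {ν : ℕ →₀ ℤ} (h : (∀ j, 0 ≤ ν j) ∨ ∀ j, ν j ≤ 0) :
    weightedLength ν = (flowDegree ν).natAbs := by
  zify
  rcases h with h | h
  · rw [weightedLength, flowDegree, Finsupp.sum, Finsupp.sum, abs_of_nonneg]
    · push_cast
      exact Finset.sum_congr rfl fun j _ => by rw [abs_of_nonneg (h j)]
    · exact Finset.sum_nonneg fun j _ => mul_nonneg (by positivity) (h j)
  · rw [weightedLength, flowDegree, Finsupp.sum, Finsupp.sum, abs_of_nonpos]
    · push_cast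
      rw [← Finset.sum_neg_distrib]
      exact Finset.sum_congr rfl fun j _ => by rw [abs_of_nonpos (h j)]; ring
    · exact Finset.sum_nonpos fun j _ => mul_nonpos_of_nonneg_of_nonpos (by positivity) (h j)

/-- The shear `(x, t) ↦ (x - (t, 2t, …), t)`. -/
def shear : Torus × UnitAddCircle ≃ₜ Torus × UnitAddCircle where
  toFun p := (p.1 - flow p.2, p.2)
  invFun p := (p.1 + flow p.2, p.2)
  left_inv p := by simp
  right_inv p := by simp
  continuous_toFun := by have := continuous_flow; fun_prop
  continuous_invFun := by have := continuous_flow; fun_prop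

/-- The lift to `𝕋^∞ × 𝕋` of a measure on `𝕋^∞`, whose slices over the first factor are its
restrictions to the orbits of the flow. -/
def flowLift (p : Measure Torus) : Measure (Torus × UnitAddCircle) :=
  (p.prod AddCircle.haarAddCircle).map shear

instance (p : Measure Torus) [IsFiniteMeasure p] : IsFiniteMeasure (flowLift p) := by
  unfold flowLift; infer_instance

lemma ae_flowLift_iff {p : Measure Torus} {P : Torus × UnitAddCircle → Prop} :
    (∀ᵐ z ∂flowLift p, P z) ↔
      ∀ᵐ z ∂p.prod (AddCircle.haarAddCircle : Measure UnitAddCircle), P (shear z) :=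
  shear.measurableEmbedding.ae_map_iff

/-- For fixed t the shear is a translation of 𝕋^∞, so it is a skew product over the circle
preserving the product measure; the swaps only put the base first. -/
lemma flowLift_haar : flowLift haar = haar.prod AddCircle.haarAddCircle := by
  have h := MeasurePreserving.skew_product (g := fun (t : UnitAddCircle) (x : Torus) => x - flow t)
    (f := id) (μa := (AddCircle.haarAddCircle : Measure UnitAddCircle))
    (μb := (AddCircle.haarAddCircle : Measure UnitAddCircle)) (μc := haar) (μd := haar)
    (MeasurePreserving.id _) (by have := continuous_flow; fun_prop)
    (Eventually.of_forall fun t => by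
      simpa [sub_eq_add_neg] using (measurePreserving_add_right_haar (-flow t)).map_eq)
  have h2 := (Measure.measurePreserving_swap.comp h).comp
    (Measure.measurePreserving_swap (μ := haar)
      (ν := (AddCircle.haarAddCircle : Measure UnitAddCircle)))
  exact h2.map_eq

/-- A property of a point of `𝕋^∞` holding almost surely on almost every orbit holds a.e. -/
lemma ae_haar_of_ae_flow {P : Torus → Prop} (hP : MeasurableSet {θ | P θ})
    (h : ∀ᵐ y ∂haar, ∀ᵐ t ∂(AddCircle.haarAddCircle : Measure UnitAddCircle), P (y + flow t)) :
    ∀ᵐ θ ∂haar, P θ := by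
  have hm : Continuous fun z : Torus × UnitAddCircle => z.1 + flow z.2 := by
    have := continuous_flow; fun_prop
  have h1 : ∀ᵐ z ∂haar.prod (AddCircle.haarAddCircle : Measure UnitAddCircle),
      P (z.1 + flow z.2) :=
    (Measure.ae_prod_iff_ae_ae (hm.measurable hP)).2 h
  rw [← flowLift_haar, ae_flowLift_iff] at h1
  simp only [shear, Homeomorph.homeomorph_mk_coe, Equiv.coe_fn_mk, sub_add_cancel] at h1
  have h2 := (Measure.ae_prod_iff_ae_ae (measurable_fst hP)).1 h1
  filter_upwards [h2] with θ hθ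
  simpa using hθ

lemma integrable_flowLift {p : Measure Torus} [IsFiniteMeasure p] {g : Torus → ℂ}
    (hg : Integrable g p) : Integrable (fun z => g (z.1 + flow z.2)) (flowLift p) := by
  rw [flowLift, shear.measurableEmbedding.integrable_map_iff]
  simpa [Function.comp_def, shear] using hg.comp_fst (AddCircle.haarAddCircle : Measure UnitAddCircle)

/-- Undoing the shear separates the variables, and orthogonality in t selects the degree n. -/
lemma integral_flowLift {p : Measure Torus} [IsFiniteMeasure p] {g : Torus → ℂ} (ν : ℕ →₀ ℤ)
    (n : ℤ) :
    ∫ z, character (-ν) z.1 * (fourier (-n) z.2 * g (z.1 + flow z.2)) ∂flowLift p =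
      if flowDegree ν = n then ∫ x, character (-ν) x * g x ∂p else 0 := by
  rw [flowLift, shear.measurableEmbedding.integral_map]
  have h : ∀ z : Torus × UnitAddCircle, character (-ν) (shear z).1 * (fourier (-n) (shear z).2 *
      g ((shear z).1 + flow (shear z).2)) =
      (character (-ν) z.1 * g z.1) * fourier (-(n - flowDegree ν)) z.2 := fun z => by
    simp only [shear, Homeomorph.homeomorph_mk_coe, Equiv.coe_fn_mk, sub_add_cancel]
    have h1 : character (-ν) (z.1 - flow z.2) =
        character (-ν) z.1 * fourier (flowDegree ν) z.2 := by
      have h2 := character_apply_add (-ν) (z.1 - flow z.2) (flow z.2)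
      rw [sub_add_cancel, character_flow, flowDegree_neg] at h2
      rw [h2, mul_assoc, ← fourier_add]
      simp
    rw [h1, neg_sub, sub_eq_add_neg, fourier_add]
    ring
  simp_rw [h]
  rw [integral_prod_mul (fun x => character (-ν) x * g x)
    (fun t : UnitAddCircle => (fourier (-(n - flowDegree ν)) t : ℂ)), integral_fourier_neg]
  by_cases hd : flowDegree ν = n
  · simp [hd]
  · rw [if_neg (sub_ne_zero.2 (Ne.symm hd)), if_neg hd, mul_zero]

/-! ### Comparison of marginals and disintegration into slices -/

/-- If `B dp` and `D dm` have the same Fourier coefficients then `D = h B` a.e., where `h` is the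
density of the absolutely continuous part of `p`. -/
theorem exists_density_of_integral_character_eq (p : Measure Torus) [IsFiniteMeasure p] :
    ∃ h : Torus → ℝ,
      (∀ P : Torus → Prop, (∀ᵐ y ∂p, P y) → ∀ᵐ y ∂haar, h y ≠ 0 → P y) ∧
      ∀ B D : Torus → ℂ, Integrable B p → Integrable D haar →
        (∀ ν, ∫ y, character ν y * D y ∂haar = ∫ y, character ν y * B y ∂p) →
        ∀ᵐ y ∂haar, D y = h y * B y := by
  -- Relative to the common dominating measure `q` both sides are integrable functions, so
  -- uniqueness makes them equal; h is the quotient of the two densities, that of `haar` being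
  -- positive m-almost everywhere.
  set q := p + haar with hq
  have hpq : p ≪ q := (Measure.le_add_right le_rfl).absolutelyContinuous
  have hmq : haar ≪ q := (Measure.le_add_left le_rfl).absolutelyContinuous
  refine ⟨fun y => (p.rnDeriv q y).toReal / (haar.rnDeriv q y).toReal, fun P hP => ?_,
    fun B D hB hD hBD => ?_⟩
  · rw [← Measure.withDensity_rnDeriv_eq p q hpq,
      ae_withDensity_iff (Measure.measurable_rnDeriv _ _)] at hP
    filter_upwards [hmq.ae_le hP] with y hy h0
    exact hy fun h => h0 (by simp [h])
  · have hB' := (integrable_rnDeriv_smul_iff hpq).2 hB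
    have hD' := (integrable_rnDeriv_smul_iff hmq).2 hD
    have hG := ae_eq_zero_of_integral_character (hB'.sub hD') fun ν => by
      have e1 := integral_rnDeriv_smul hpq (f := fun y => character ν y * B y)
      have e2 := integral_rnDeriv_smul hmq (f := fun y => character ν y * D y)
      have i1 := integrable_character_mul hB' ν
      have i2 := integrable_character_mul hD' ν
      simp only [Pi.sub_apply, mul_sub]
      rw [integral_sub i1 i2, sub_eq_zero]
      simp_rw [mul_smul_comm]
      rw [e1, e2, hBD]
    filter_upwards [hmq.ae_le hG, Measure.rnDeriv_pos hmq,
      hmq.ae_le (Measure.rnDeriv_lt_top haar q)] with y h1 h2 h3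
    have hb : ((haar.rnDeriv q y).toReal : ℂ) ≠ 0 :=
      Complex.ofReal_ne_zero.2 (ENNReal.toReal_pos h2.ne' h3.ne).ne'
    simp only [Pi.sub_apply, Pi.zero_apply, sub_eq_zero, Complex.real_smul] at h1
    push_cast
    rw [div_mul_eq_mul_div, eq_div_iff hb, h1, mul_comm]

/-- The slices of the lift of a singular measure are singular. -/
lemma ae_condKernel_mutuallySingular {p : Measure Torus} [IsFiniteMeasure p] (hp : p ⟂ₘ haar) :
    ∃ E : Set (Torus × UnitAddCircle), MeasurableSet E ∧
      (∀ᵐ y ∂(flowLift p).fst, (flowLift p).condKernel y (Prod.mk y ⁻¹' E) = 0) ∧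
      ∀ᵐ y ∂haar, AddCircle.haarAddCircle (Prod.mk y ⁻¹' E)ᶜ = 0 := by
  obtain ⟨s, hs, hs1, hs2⟩ := hp
  have hm : Continuous fun z : Torus × UnitAddCircle => z.1 + flow z.2 := by
    have := continuous_flow; fun_prop
  have hlift : ∀ {m : Measure Torus} [IsFiniteMeasure m] {u : Set Torus}, MeasurableSet u →
      m u = 0 → ∀ᵐ z ∂flowLift m, z.1 + flow z.2 ∉ u := fun {m} _ {u} hu hu0 => by
    rw [ae_flowLift_iff]
    simp only [shear, Homeomorph.homeomorph_mk_coe, Equiv.coe_fn_mk, sub_add_cancel]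
    refine (Measure.ae_prod_iff_ae_ae (measurable_fst hu.compl)).2 ?_
    filter_upwards [measure_eq_zero_iff_ae_notMem.1 hu0] with x hx
    exact Eventually.of_forall fun _ => hx
  -- E is the preimage under (y, t) ↦ y + `flow` t of a set null for p with m-null complement.
  -- Preimages of null sets are null for the lifts, and so are almost all their slices.
  refine ⟨(fun z : Torus × UnitAddCircle => z.1 + flow z.2) ⁻¹' s, hm.measurable hs, ?_, ?_⟩
  · have h1 := hlift hs hs1
    rw [← (flowLift p).disintegrate (flowLift p).condKernel] at h1
    filter_upwards [Measure.ae_ae_of_ae_compProd h1] with y hy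
    exact measure_eq_zero_iff_ae_notMem.2 hy
  · have h1 := hlift hs.compl hs2
    rw [flowLift_haar] at h1
    filter_upwards [Measure.ae_ae_of_ae_prod h1] with y hy
    exact measure_eq_zero_iff_ae_notMem.2 hy

lemma integrable_fourier_mul_flowLift {p : Measure Torus} [IsFiniteMeasure p] {g : Torus → ℂ}
    (hg : Integrable g p) (n : ℤ) :
    Integrable (fun z => fourier (-n) z.2 * g (z.1 + flow z.2)) (flowLift p) := by
  have hc : Continuous fun z : Torus × UnitAddCircle => (fourier (-n) z.2 : ℂ) :=
    (fourier (-n)).continuous.comp continuous_snd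
  exact Integrable.bdd_mul (integrable_flowLift hg) hc.aestronglyMeasurable
    (Eventually.of_forall fun z => (norm_fourier_apply (-n) z.2).le)

lemma integrable_character_mul_flowLift {p : Measure Torus} [IsFiniteMeasure p] {g : Torus → ℂ}
    (hg : Integrable g p) (n : ℤ) (ν : ℕ →₀ ℤ) :
    Integrable (fun z => character ν z.1 * (fourier (-n) z.2 * g (z.1 + flow z.2)))
      (flowLift p) := by
  have hc : Continuous fun z : Torus × UnitAddCircle => character ν z.1 :=
    (continuous_character ν).comp continuous_fst
  exact Integrable.bdd_mul (integrable_fourier_mul_flowLift hg n) hc.aestronglyMeasurable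
    (Eventually.of_forall fun z => (norm_character ν z.1).le)

/-- The Fourier coefficients of the slices of a measure `g dp`, the slices being taken with respect
to the first marginal of the lift of `p`. -/
lemma integral_character_mul_condKernel {p : Measure Torus} [IsFiniteMeasure p] {g : Torus → ℂ}
    (hg : Integrable g p) (n : ℤ) (ν : ℕ →₀ ℤ) :
    ∫ y, character (-ν) y * ∫ t, fourier (-n) t * g (y + flow t) ∂(flowLift p).condKernel y
      ∂(flowLift p).fst = if flowDegree ν = n then ∫ x, character (-ν) x * g x ∂p else 0 := by
  rw [← integral_flowLift ν n, ← Measure.integral_condKernel]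
  · simp_rw [← integral_const_mul]
  · exact integrable_character_mul_flowLift hg n (-ν)

lemma integral_character_mul_haar {g : Torus → ℂ}
    (hg : Integrable g haar) (n : ℤ) (ν : ℕ →₀ ℤ) :
    ∫ y, character (-ν) y * ∫ t, fourier (-n) t * g (y + flow t) ∂AddCircle.haarAddCircle
      ∂haar = if flowDegree ν = n then ∫ x, character (-ν) x * g x ∂haar else 0 := by
  rw [← integral_flowLift ν n, flowLift_haar, integral_prod]
  · simp_rw [← integral_const_mul]
  · rw [← flowLift_haar]
    exact integrable_character_mul_flowLift hg n (-ν)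

/-! ### Fourier series along orbits -/

/-- The `n`-th Fourier coefficient along the flow of the Fourier series with coefficients `c`. -/
def orbitCoeff (c : (ℕ →₀ ℤ) → ℂ) (n : ℤ) (y : Torus) : ℂ :=
  ∑' ν : ℕ →₀ ℤ, if flowDegree ν = n then c ν * character ν y else 0

section

variable {c : (ℕ →₀ ℤ) → ℂ} {C : ℝ}

/-- A nonzero term has weighted length |n|, so the inserted factor 2^|n| (1/2)^|n| is 1; the
resulting bound is summable over ν and uniform in y. -/
lemma norm_orbitTerm_le (hc : SpectrumInHalves c) (hC : ∀ ν, ‖c ν‖ ≤ C) (n : ℤ) (y : Torus)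
    (ν : ℕ →₀ ℤ) :
    ‖if flowDegree ν = n then c ν * character ν y else 0‖ ≤
      C * 2 ^ n.natAbs * (1 / 2) ^ weightedLength ν := by
  have hC0 : 0 ≤ C := (norm_nonneg _).trans (hC 0)
  split_ifs with h
  · by_cases h0 : c ν = 0
    · rw [h0, zero_mul, norm_zero]; positivity
    · rw [weightedLength_eq (hc ν h0), h, norm_mul, norm_character, mul_one, mul_assoc,
        ← mul_pow]
      simpa using hC ν
  · rw [norm_zero]; positivity

lemma summable_orbitBound (C : ℝ) (n : ℤ) :
    Summable fun ν => C * 2 ^ n.natAbs * (1 / 2 : ℝ) ^ weightedLength ν :=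
  (summable_pow_weightedLength ⟨by norm_num, by norm_num⟩).mul_left _

lemma continuous_orbitTerm (n : ℤ) (ν : ℕ →₀ ℤ) :
    Continuous fun y => if flowDegree ν = n then c ν * character ν y else 0 := by
  split_ifs
  · exact continuous_const.mul (continuous_character ν)
  · exact continuous_const

lemma integrable_orbitTerm (n : ℤ) (ν : ℕ →₀ ℤ) :
    Integrable (fun y => if flowDegree ν = n then c ν * character ν y else 0) haar :=
  (continuous_orbitTerm n ν).integrable_of_hasCompactSupport (HasCompactSupport.of_compactSpace _)

lemma continuous_orbitCoeff (hc : SpectrumInHalves c) (hC : ∀ ν, ‖c ν‖ ≤ C) (n : ℤ) :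
    Continuous (orbitCoeff c n) :=
  continuous_tsum (continuous_orbitTerm n) (summable_orbitBound C n)
    fun ν y => norm_orbitTerm_le hc hC n y ν

lemma integrable_orbitCoeff (hc : SpectrumInHalves c) (hC : ∀ ν, ‖c ν‖ ≤ C) (n : ℤ) :
    Integrable (orbitCoeff c n) haar :=
  (continuous_orbitCoeff hc hC n).integrable_of_hasCompactSupport
    (HasCompactSupport.of_compactSpace _)

lemma integral_character_mul_orbitCoeff (hc : SpectrumInHalves c) (hC : ∀ ν, ‖c ν‖ ≤ C) (n : ℤ)
    (ν : ℕ →₀ ℤ) :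
    ∫ y, character (-ν) y * orbitCoeff c n y ∂haar = if flowDegree ν = n then c ν else 0 := by
  simp_rw [orbitCoeff, ← tsum_mul_left]
  rw [← integral_tsum_of_summable_integral_norm]
  · rw [tsum_eq_single ν]
    · split_ifs with h
      · simp_rw [mul_left_comm _ (c ν), character_neg_mul_self]
        simp
      · simp
    · intro ν' hν'
      split_ifs with h
      · simp_rw [mul_left_comm _ (c ν'), ← character_add]
        rw [integral_const_mul, integral_character_haar, if_neg, mul_zero]
        intro h0; exact hν' (neg_add_eq_zero.1 h0).symm
      · simp
  · exact fun ν' => integrable_character_mul (integrable_orbitTerm n ν') (-ν)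
  · refine Summable.of_nonneg_of_le (fun ν' => integral_nonneg fun _ => norm_nonneg _)
      (fun ν' => ?_) (summable_orbitBound C n)
    simp_rw [norm_mul (character _ _), norm_character, one_mul]
    refine (integral_mono (integrable_orbitTerm n ν').norm (integrable_const _)
      fun y => norm_orbitTerm_le hc hC n y ν').trans_eq ?_
    simp

lemma norm_radialTerm_le (hC : ∀ ν, ‖c ν‖ ≤ C) {r ρ : ℝ} (h0 : 0 ≤ r) (hr : r ≤ ρ) (θ : Torus)
    (ν : ℕ →₀ ℤ) :
    ‖c ν * (r : ℂ) ^ weightedLength ν * character ν θ‖ ≤ C * ρ ^ weightedLength ν := by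
  rw [norm_mul, norm_mul, norm_character, norm_pow, Complex.norm_real, Real.norm_of_nonneg h0,
    mul_one]
  have hC0 : 0 ≤ C := (norm_nonneg _).trans (hC 0)
  gcongr
  exact hC ν

lemma summable_radialTerm (hC : ∀ ν, ‖c ν‖ ≤ C) {r : ℝ} (hr : r ∈ Set.Ioo (0 : ℝ) 1) (θ : Torus) :
    Summable fun ν => c ν * (r : ℂ) ^ weightedLength ν * character ν θ :=
  Summable.of_norm_bounded ((summable_pow_weightedLength hr).mul_left C)
    (norm_radialTerm_le hC hr.1.le le_rfl θ)

/-- The absolutely convergent series is regrouped by flow degree; within degree n the factors r^|n|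
and e^{2πint} are constant. -/
lemma hasSum_orbitCoeff (hc : SpectrumInHalves c) (hC : ∀ ν, ‖c ν‖ ≤ C) {r : ℝ}
    (hr : r ∈ Set.Ioo (0 : ℝ) 1) (y : Torus) (t : UnitAddCircle) :
    HasSum (fun n : ℤ => (r : ℂ) ^ n.natAbs * fourier n t * orbitCoeff c n y)
      (∑' ν, c ν * (r : ℂ) ^ weightedLength ν * character ν (y + flow t)) := by
  refine ((summable_radialTerm hC hr (y + flow t)).hasSum.tsum_fiberwise flowDegree).congr_fun
    fun n => ?_
  rw [tsum_subtype (flowDegree ⁻¹' {n}) fun ν : ℕ →₀ ℤ =>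
    c ν * (r : ℂ) ^ weightedLength ν * character ν (y + flow t), orbitCoeff, ← tsum_mul_left]
  congr 1 with ν
  by_cases h : flowDegree ν = n
  · rw [if_pos h, Set.indicator_of_mem (by exact h), character_apply_add, character_flow, h]
    by_cases h0 : c ν = 0
    · simp [h0]
    · rw [weightedLength_eq (hc ν h0), h]; ring
  · rw [if_neg h, Set.indicator_of_notMem (by exact h), mul_zero]

lemma continuous_radialSum (hC : ∀ ν, ‖c ν‖ ≤ C) {r : ℝ} (hr : r ∈ Set.Ioo (0 : ℝ) 1) :
    Continuous fun θ => ∑' ν, c ν * (r : ℂ) ^ weightedLength ν * character ν θ :=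
  continuous_tsum (fun ν => continuous_const.mul (continuous_character ν))
    ((summable_pow_weightedLength hr).mul_left C)
    fun ν θ => norm_radialTerm_le hC hr.1.le le_rfl θ ν

lemma continuousOn_radialSum (hC : ∀ ν, ‖c ν‖ ≤ C) (θ : Torus) :
    ContinuousOn (fun r : ℝ => ∑' ν, c ν * (r : ℂ) ^ weightedLength ν * character ν θ)
      (Set.Ioo 0 1) := by
  intro r hr
  obtain ⟨ρ, hρ, hρ1⟩ := exists_between hr.2
  have h : ContinuousOn (fun r : ℝ => ∑' ν, c ν * (r : ℂ) ^ weightedLength ν * character ν θ)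
      (Set.Ioo 0 ρ) :=
    continuousOn_tsum (fun ν => by fun_prop)
      ((summable_pow_weightedLength ⟨hr.1.trans hρ, hρ1⟩).mul_left C)
      fun ν s hs => norm_radialTerm_le hC hs.1.le hs.2.le θ ν
  exact (h.continuousAt (Ioo_mem_nhds hr.1 hρ)).continuousWithinAt

end

/-! ### Measurability and radial convergence -/

/-- The set of points at which a family depending continuously on `r` has a given radial limit is
measurable. -/
lemma measurableSet_tendsto_radial {X : Type*} [MeasurableSpace X] {F : ℝ → X → ℂ} {f : X → ℂ}
    (hf : Measurable f) (hF : ∀ r ∈ Set.Ioo (0 : ℝ) 1, Measurable (F r))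
    (hc : ∀ x, ContinuousOn (fun r => F r x) (Set.Ioo 0 1)) :
    MeasurableSet {x | Tendsto (fun r => F r x) (𝓝[<] 1) (𝓝 (f x))} := by
  -- Continuity in r allows rational radii only; the shift m + 2 keeps them in (1/2, 1), inside the
  -- domain of continuity.
  have key : {x | Tendsto (fun r => F r x) (𝓝[<] 1) (𝓝 (f x))} =
      ⋂ k : ℕ, ⋃ m : ℕ, ⋂ q : ℚ, {x | (q : ℝ) ∈ Set.Ioo (1 - 1 / ((m : ℝ) + 2)) 1 →
        ‖F q x - f x‖ ≤ 1 / ((k : ℝ) + 1)} := by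
    ext x
    simp only [Set.mem_ofPred_eq, Set.mem_iInter, Set.mem_iUnion]
    constructor
    · intro h k
      have h1 : ∀ᶠ r in 𝓝[<] (1 : ℝ), ‖F r x - f x‖ ≤ 1 / ((k : ℝ) + 1) := by
        filter_upwards [h (Metric.closedBall_mem_nhds (f x) (Nat.one_div_pos_of_nat (n := k)))]
          with r hr
        simpa [dist_eq_norm] using hr
      obtain ⟨l, hl, hl'⟩ := mem_nhdsLT_iff_exists_Ioo_subset.1 h1
      have hl1 : 0 < 1 - l := by simpa using hl
      obtain ⟨m, hm⟩ := exists_nat_one_div_lt hl1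
      refine ⟨m, fun q hq => hl' ⟨?_, hq.2⟩⟩
      have : 1 / ((m : ℝ) + 2) ≤ 1 / ((m : ℝ) + 1) := by gcongr; norm_num
      linarith [hq.1]
    · intro h
      rw [Metric.tendsto_nhds]
      intro ε hε
      obtain ⟨k, hk⟩ := exists_nat_one_div_lt hε
      obtain ⟨m, hm⟩ := h k
      have hm1 : 1 / ((m : ℝ) + 2) ≤ 1 / 2 := by gcongr; simp
      have hm0 : 0 < 1 / ((m : ℝ) + 2) := by positivity
      filter_upwards [Ioo_mem_nhdsLT (show 1 - 1 / ((m : ℝ) + 2) < 1 by linarith)] with r hr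
      rw [dist_eq_norm]
      refine lt_of_le_of_lt ?_ hk
      have hr0 : r ∈ Set.Ioo (0 : ℝ) 1 := ⟨by linarith [hr.1], hr.2⟩
      have hcont : ContinuousAt (fun s => ‖F s x - f x‖) r :=
        (((hc x).continuousAt (Ioo_mem_nhds hr0.1 hr0.2)).sub continuousAt_const).norm
      have hcl : r ∈ closure (Set.range ((↑) : ℚ → ℝ) ∩ Set.Ioo (1 - 1 / ((m : ℝ) + 2)) 1) := by
        have := Rat.isDenseEmbedding_coe_real.dense.open_subset_closure_inter
          (isOpen_Ioo (a := 1 - 1 / ((m : ℝ) + 2)) (b := 1)) hr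
        rwa [Set.inter_comm] at this
      obtain ⟨u, hu, hu'⟩ := mem_closure_iff_seq_limit.1 hcl
      refine le_of_tendsto (hcont.tendsto.comp hu') (Eventually.of_forall fun i => ?_)
      obtain ⟨⟨q, hq⟩, hi⟩ := hu i
      rw [← hq] at hi
      simpa [← hq] using hm q hi
  rw [key]
  refine MeasurableSet.iInter fun k => MeasurableSet.iUnion fun m => MeasurableSet.iInter fun q => ?_
  by_cases hq : (q : ℝ) ∈ Set.Ioo (1 - 1 / ((m : ℝ) + 2)) 1
  · have hm1 : 1 / ((m : ℝ) + 2) ≤ 1 / 2 := by gcongr; simp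
    have hq0 : (q : ℝ) ∈ Set.Ioo (0 : ℝ) 1 := ⟨by linarith [hq.1], hq.2⟩
    simp only [hq, forall_const]
    exact measurableSet_le ((hF q hq0).sub hf).norm measurable_const
  · convert MeasurableSet.univ (α := X)
    exact Set.eq_univ_of_forall fun x hx => absurd hx hq

/-- Radial convergence a.e. of the Fourier series of `f dm + g dp`, where `p` is singular and the
spectrum of the sum lies in the two halves. -/
theorem ae_tendsto_radialSum {c : (ℕ →₀ ℤ) → ℂ} {C : ℝ} (hc : SpectrumInHalves c)
    (hC : ∀ ν, ‖c ν‖ ≤ C) {f g : Torus → ℂ} (hfm : Measurable f) (hf : Integrable f haar)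
    {p : Measure Torus} [IsFiniteMeasure p] (hp : p ⟂ₘ haar) (hg : Integrable g p)
    (hcfg : ∀ ν, c ν = ∫ x, character (-ν) x * f x ∂haar + ∫ x, character (-ν) x * g x ∂p) :
    ∀ᵐ θ ∂haar, Tendsto (fun r : ℝ => ∑' ν, c ν * (r : ℂ) ^ weightedLength ν * character ν θ)
      (𝓝[<] 1) (𝓝 (f θ)) := by
  refine ae_haar_of_ae_flow (measurableSet_tendsto_radial hfm
    (fun r hr => (continuous_radialSum hC hr).measurable) (continuousOn_radialSum hC)) ?_
  set K := (flowLift p).condKernel with hK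
  set α : ℤ → Torus → ℂ := fun n y =>
    ∫ t, fourier (-n) t * f (y + flow t) ∂AddCircle.haarAddCircle with hα
  set B : ℤ → Torus → ℂ := fun n y => ∫ t, fourier (-n) t * g (y + flow t) ∂K y with hB
  have hαi : ∀ n, Integrable (α n) haar := fun n => by
    have h := integrable_fourier_mul_flowLift hf n
    rw [flowLift_haar] at h
    exact h.integral_prod_left
  have hBi : ∀ n, Integrable (B n) (flowLift p).fst := fun n =>
    (integrable_fourier_mul_flowLift hg n).integral_condKernel
  obtain ⟨h, hac, hdens⟩ := exists_density_of_integral_character_eq (flowLift p).fst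
  -- Tested against characters, both sides give the coefficient of g dp at ν when ν has degree n,
  -- and 0 otherwise. Countability of the n yields one null set.
  have hcoef : ∀ᵐ y ∂haar, ∀ n, orbitCoeff c n y - α n y = h y * B n y := by
    rw [ae_all_iff]
    intro n
    refine hdens (B n) _ (hBi n) ((integrable_orbitCoeff hc hC n).sub (hαi n)) fun ν' => ?_
    obtain ⟨ν, rfl⟩ : ∃ ν, ν' = -ν := ⟨-ν', (neg_neg _).symm⟩
    simp only [mul_sub]
    rw [integral_sub (integrable_character_mul (integrable_orbitCoeff hc hC n) _)
      (integrable_character_mul (hαi n) _), integral_character_mul_orbitCoeff hc hC,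
      integral_character_mul_haar hf, integral_character_mul_condKernel hg]
    split_ifs
    · rw [hcfg]; ring
    · simp
  obtain ⟨E, hE, hE1, hE2⟩ := ae_condKernel_mutuallySingular hp
  have hgK : ∀ᵐ y ∂(flowLift p).fst, Integrable (fun t => g (y + flow t)) (K y) :=
    (integrable_flowLift hg).condKernel_ae
  have hfs : ∀ᵐ y ∂haar, Integrable (fun t => f (y + flow t))
      (AddCircle.haarAddCircle : Measure UnitAddCircle) := by
    have h := integrable_flowLift hf
    rw [flowLift_haar] at h
    exact h.prod_right_ae
  filter_upwards [hcoef, hac _ (hE1.and hgK), hE2, hfs] with y hcy hsy hEy hfy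
  -- The slice is controlled only where h(y) ≠ 0; elsewhere the factor h(y) removes it.
  have hs : ∀ᵐ t ∂(AddCircle.haarAddCircle : Measure UnitAddCircle), Tendsto (fun r : ℝ =>
      (h y : ℂ) * ∫ s, circlePoisson r (t - s) * g (y + flow s) ∂K y) (𝓝[<] 1) (𝓝 0) := by
    by_cases hy : h y = 0
    · simp [hy]
    · obtain ⟨h1, h2⟩ := hsy hy
      filter_upwards [ae_tendsto_circlePoisson_of_mutuallySingular
        ⟨_, measurable_prodMk_left hE, h1, hEy⟩ h2] with t ht
      simpa using ht.const_mul (h y : ℂ)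
  filter_upwards [ae_tendsto_circlePoisson hfy, hs] with t ht1 ht2
  have ht := ht1.add ht2
  rw [add_zero] at ht
  refine ht.congr' ?_
  filter_upwards [Ioo_mem_nhdsLT (zero_lt_one' ℝ)] with r hr
  have e1 := hasSum_integral_circlePoisson hr hfy t
  have e2 : HasSum (fun n : ℤ => (r : ℂ) ^ n.natAbs * fourier n t * (h y * B n y))
      (h y * ∫ s, circlePoisson r (t - s) * g (y + flow s) ∂K y) := by
    by_cases hy : h y = 0
    · simp [hy, hasSum_zero]
    · refine ((hasSum_integral_circlePoisson hr (hsy hy).2 t).mul_left (h y : ℂ)).congr_fun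
        fun n => ?_
      ring
  refine (e1.add e2).unique ?_
  refine (hasSum_orbitCoeff hc hC hr y t).congr_fun fun n => ?_
  rw [← hcy n]
  ring

/-! ### Complex measures with density -/

section VectorMeasure

variable {X : Type*} [MeasurableSpace X] {p : Measure X} {g : X → ℂ}

/-- The variation is |g| dp, and φg is |g|φ times the bounded function g/|g|, read as 0 where g
vanishes. -/
lemma integrable_mul_of_integrable_variation (hg : Integrable g p) {φ : X → ℂ}
    (hφ : Integrable φ (p.withDensityᵥ g).variation) : Integrable (fun x => φ x * g x) p := by
  rw [Measure.variation_withDensityᵥ hg, integrable_withDensity_iff_integrable_smul₀' hg.1.enorm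
    (Eventually.of_forall fun x => enorm_lt_top)] at hφ
  have hu : AEStronglyMeasurable (fun x => g x / (‖g x‖ : ℂ)) p :=
    (hg.1.aemeasurable.div (Complex.measurable_ofReal.comp_aemeasurable
      hg.1.aemeasurable.norm)).aestronglyMeasurable
  refine (hφ.bdd_mul (c := 1) hu (Eventually.of_forall fun x => ?_)).congr
    (Eventually.of_forall fun x => ?_)
  · rw [norm_div, Complex.norm_real, norm_norm]
    exact div_self_le_one _
  · simp only [toReal_enorm, Complex.real_smul]
    by_cases h : g x = 0
    · simp [h]
    · have : (‖g x‖ : ℂ) ≠ 0 := by simpa using h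
      field_simp

lemma enorm_integral_mul_le (hg : Integrable g p) {φ : X → ℂ}
    (hφ : Integrable φ (p.withDensityᵥ g).variation) :
    ‖∫ x, φ x * g x ∂p‖ₑ ≤ ∫⁻ x, ‖φ x‖ₑ ∂(p.withDensityᵥ g).variation := by
  refine (enorm_integral_le_lintegral_enorm _).trans_eq ?_
  rw [Measure.variation_withDensityᵥ hg] at hφ ⊢
  rw [lintegral_withDensity_eq_lintegral_mul₀' hg.1.enorm hφ.1.enorm]
  simp [enorm_mul, mul_comm]

/-- Integration against a complex measure with density. -/
theorem integral_withDensityᵥ (hg : Integrable g p) {φ : X → ℂ}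
    (hφ : Integrable φ (p.withDensityᵥ g).variation) :
    VectorMeasure.integral (p.withDensityᵥ g) φ (ContinuousLinearMap.mul ℝ ℂ) =
      ∫ x, φ x * g x ∂p := by
  refine Integrable.induction (fun φ => VectorMeasure.integral (p.withDensityᵥ g) φ
    (ContinuousLinearMap.mul ℝ ℂ) = ∫ x, φ x * g x ∂p) ?_ ?_ ?_ ?_ hφ
  · intro c s hs hfin
    rw [VectorMeasure.integral_eq_setToFun, setToFun_indicator_const _ hs hfin.ne]
    change c * (p.withDensityᵥ g) s = _
    rw [withDensityᵥ_apply hg hs, ← integral_const_mul, ← integral_indicator hs]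
    congr 1 with x
    by_cases hx : x ∈ s <;> simp [hx]
  · intro φ ψ _ hφ hψ h1 h2
    rw [VectorMeasure.integral_add hφ hψ, h1, h2, ← integral_add
      (integrable_mul_of_integrable_variation hg hφ)
      (integrable_mul_of_integrable_variation hg hψ)]
    simp [add_mul]
  · refine isClosed_eq VectorMeasure.continuous_integral ?_
    -- The right-hand side is 1-Lipschitz for the L¹ distance of the variation.
    refine (LipschitzWith.of_edist_le fun φ ψ => ?_).continuous
    have hi := fun χ : X →₁[(p.withDensityᵥ g).variation] ℂ =>
      integrable_mul_of_integrable_variation hg (L1.integrable_coeFn χ)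
    rw [edist_eq_enorm_sub, ← integral_sub (hi φ) (hi ψ),
      L1.edist_def]
    simp_rw [← sub_mul, edist_eq_enorm_sub]
    exact enorm_integral_mul_le hg ((L1.integrable_coeFn φ).sub (L1.integrable_coeFn ψ))
  · intro φ ψ h hφ h1
    rw [← VectorMeasure.integral_congr_ae h, h1]
    -- Equality holds almost everywhere for the variation only, not for p, so the norm bound is
    -- applied to φ - ψ.
    have h2 := enorm_integral_mul_le hg (hφ.sub (hφ.congr h))
    rw [lintegral_congr_ae (g := 0) (by
      filter_upwards [h] with x hx
      simp [hx])] at h2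
    simp only [Pi.sub_apply, sub_mul] at h2
    rw [integral_sub (integrable_mul_of_integrable_variation hg hφ)
      (integrable_mul_of_integrable_variation hg (hφ.congr h))] at h2
    simpa [sub_eq_zero] using h2

/-- A complex measure singular to a positive measure `m` has an integrable density with respect to
a finite positive measure singular to `m`. -/
theorem exists_eq_withDensityᵥ_of_mutuallySingular {μ : ComplexMeasure X} {m : Measure X}
    (h : VectorMeasure.MutuallySingular μ m.toENNRealVectorMeasure) :
    ∃ (p : Measure X) (g : X → ℂ), IsFiniteMeasure p ∧ p ⟂ₘ m ∧ Integrable g p ∧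
      μ = p.withDensityᵥ g := by
  -- This measure dominates both real and imaginary parts, and inherits singularity to m from each.
  set p := μ.re.totalVariation + μ.im.totalVariation with hp
  have hfin : IsFiniteMeasure p := by
    rw [hp, SignedMeasure.totalVariation, SignedMeasure.totalVariation]; infer_instance
  have hre : μ.re ≪ᵥ p.toENNRealVectorMeasure := by
    refine VectorMeasure.AbsolutelyContinuous.mk fun s hs h0 => ?_
    rw [Measure.toENNRealVectorMeasure_apply_measurable hs, hp, Measure.add_apply,
      add_eq_zero] at h0
    exact SignedMeasure.null_of_totalVariation_zero _ h0.1
  have him : μ.im ≪ᵥ p.toENNRealVectorMeasure := by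
    refine VectorMeasure.AbsolutelyContinuous.mk fun s hs h0 => ?_
    rw [Measure.toENNRealVectorMeasure_apply_measurable hs, hp, Measure.add_apply,
      add_eq_zero] at h0
    exact SignedMeasure.null_of_totalVariation_zero _ h0.2
  obtain ⟨s, hs, h1, h2⟩ := h
  have sing : ∀ σ : SignedMeasure X, (∀ t, μ t = 0 → σ t = 0) → σ.totalVariation ⟂ₘ m :=
    fun σ hσ => by
      have : σ ⟂ᵥ m.toENNRealVectorMeasure := ⟨s, hs, fun t ht => hσ t (h1 t ht), h2⟩
      rw [SignedMeasure.mutuallySingular_ennreal_iff] at this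
      rwa [show m.toENNRealVectorMeasure.ennrealToMeasure = m from
        VectorMeasure.equivMeasure.right_inv m] at this
  refine ⟨p, μ.rnDeriv p, hfin, ?_, ComplexMeasure.integrable_rnDeriv _ _, ?_⟩
  · refine Measure.MutuallySingular.add_left (sing _ fun t ht => ?_) (sing _ fun t ht => ?_)
    · change (μ t).re = 0; rw [ht]; rfl
    · change (μ t).im = 0; rw [ht]; rfl
  · have e1 := SignedMeasure.withDensityᵥ_rnDeriv_eq _ p hre
    have e2 := SignedMeasure.withDensityᵥ_rnDeriv_eq _ p him
    have hi := ComplexMeasure.integrable_rnDeriv μ p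
    ext t ht
    rw [withDensityᵥ_apply hi ht]
    apply Complex.ext
    · rw [← RCLike.re_eq_complex_re, ← integral_re hi.integrableOn]
      change μ.re t = _
      rw [← e1, withDensityᵥ_apply (SignedMeasure.integrable_rnDeriv _ _) ht]
      rfl
    · rw [← RCLike.im_eq_complex_im, ← integral_im hi.integrableOn]
      change μ.im t = _
      rw [← e2, withDensityᵥ_apply (SignedMeasure.integrable_rnDeriv _ _) ht]
      rfl

end VectorMeasure

/-! ### Fourier coefficients of the measure and conclusion -/

lemma integrable_character_variation {p : Measure Torus} {g : Torus → ℂ} (hg : Integrable g p)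
    (ν : ℕ →₀ ℤ) : Integrable (character ν) (p.withDensityᵥ g).variation := by
  rw [Measure.variation_withDensityᵥ hg]
  have : IsFiniteMeasure (p.withDensity (‖g ·‖ₑ)) := isFiniteMeasure_withDensity hg.2.ne
  exact (continuous_character ν).integrable_of_hasCompactSupport
    (HasCompactSupport.of_compactSpace _)

lemma measureCoeff_withDensityᵥ {p : Measure Torus} {g : Torus → ℂ} (hg : Integrable g p)
    (ν : ℕ →₀ ℤ) : measureCoeff (p.withDensityᵥ g) ν = ∫ θ, character (-ν) θ * g θ ∂p :=
  integral_withDensityᵥ hg (integrable_character_variation hg _)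

lemma norm_integral_character_mul_le (p : Measure Torus) (g : Torus → ℂ) (ν : ℕ →₀ ℤ) :
    ‖∫ θ, character ν θ * g θ ∂p‖ ≤ ∫ θ, ‖g θ‖ ∂p := by
  refine (norm_integral_le_integral_norm _).trans_eq ?_
  simp [norm_character]

end InfTorus

end

theorem mainTheorem4 (μ μs : MeasureTheory.ComplexMeasure InfTorus.Torus)
    (f : InfTorus.Torus → ℂ)
    (hf : MeasureTheory.Integrable f InfTorus.haar)
    (hs : MeasureTheory.VectorMeasure.MutuallySingular μs
      InfTorus.haar.toENNRealVectorMeasure)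
    (hμ : μ = InfTorus.haar.withDensityᵥ f + μs)
    (hfspec : InfTorus.SpectrumInHalves (InfTorus.functionCoeff f))
    (hsspec : InfTorus.SpectrumInHalves (InfTorus.measureCoeff μs)) :
    (∀ r ∈ Set.Ioo (0 : ℝ) 1, ∀ θ : InfTorus.Torus, Summable (InfTorus.radialTerm μ r θ)) ∧
    ∀ᵐ θ ∂InfTorus.haar,
      Tendsto (fun r : ℝ => InfTorus.radialExtension μ r θ) (𝓝[<] (1 : ℝ)) (𝓝 (f θ)) := by
  open InfTorus in
  obtain ⟨p, g, hpf, hp, hg, rfl⟩ := exists_eq_withDensityᵥ_of_mutuallySingular hs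
  have hcoef : ∀ ν, measureCoeff μ ν = functionCoeff f ν + measureCoeff (p.withDensityᵥ g) ν := by
    intro ν
    rw [hμ, measureCoeff, VectorMeasure.integral_add_vectorMeasure
      (integrable_character_variation hf _) (integrable_character_variation hg _)]
    congr 1
    exact measureCoeff_withDensityᵥ hf ν
  have hc : SpectrumInHalves (measureCoeff μ) := fun ν hν => by
    by_cases h0 : functionCoeff f ν = 0
    · rw [hcoef, h0, zero_add] at hν; exact hsspec ν hν
    · exact hfspec ν h0
  have hC : ∀ ν, ‖measureCoeff μ ν‖ ≤ ∫ θ, ‖f θ‖ ∂haar + ∫ θ, ‖g θ‖ ∂p := fun ν => by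
    rw [hcoef, measureCoeff_withDensityᵥ hg]
    exact (norm_add_le _ _).trans (add_le_add (norm_integral_character_mul_le _ _ _)
      (norm_integral_character_mul_le _ _ _))
  refine ⟨fun r hr θ => summable_radialTerm hC hr θ, ?_⟩
  -- Measurability of the convergence set calls for a measurable representative of f.
  have hff := hf.1.ae_eq_mk
  have h := ae_tendsto_radialSum hc hC hf.1.stronglyMeasurable_mk.measurable (hf.congr hff) hp hg
    fun ν => by
      rw [hcoef, measureCoeff_withDensityᵥ hg, functionCoeff]
      congr 1
      refine integral_congr_ae ?_
      filter_upwards [hff] with θ hθ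
      rw [hθ]
  filter_upwards [h, hff] with θ h1 h2
  rw [h2]
  exact h1
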